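/- Let $X$ be a finitely suslinean continuum with more than one point, i.e. a compact connected metric space with at least two points such that for every family of pairwise disjoint subcontinua (nonempty compact connected subsets) of $X$ and every $\varepsilon>0$, all but finitely many members of the family have diameter less than $\varepsilon$. Let $f\colon X\to X$ be a continuous map that is minimal, i.e. the only nonempty closed set $M\subseteq X$ with $f(M)\subseteq M$ is $X$ itself. Then $f$ is not (topologically) weakly mixing: the product map $f\times f\colon X\times X\to X\times X$, $(x,y)\mapsto(f(x),f(y))$, is not transitive, where a map $g\colon Y\to Y$ is called transitive if for any two nonempty open sets $U,V\subseteq Y$ there is an integer $n\ge 1$ with $g^{n}(U)\cap V\neq\emptyset$. -/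

import Mathlib

/-- A subcontinuum of `X`: a nonempty, connected, compact subset
(`IsConnected` includes nonemptiness). -/
def IsSubcontinuum {X : Type*} [TopologicalSpace X] (A : Set X) : Prop :=
  IsCompact A ∧ IsConnected A

/-- A family of subsets of a metric space is null if, for every `ε > 0`, all but finitely many of
its members have diameter less than `ε`. -/
def IsNullFamily {X : Type*} [MetricSpace X] {ι : Type*} (A : ι → Set X) : Prop :=
  ∀ ε : ℝ, 0 < ε → ∃ J : Finset ι, ∀ i, i ∉ J → Metric.diam (A i) < ε

/-- A finitely suslinean continuum: a nonempty compact connected metric space in which every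
pairwise disjoint family of subcontinua is null. As subcontinua are nonempty, the members of a
pairwise disjoint family are distinct, so families may be given as sets of subsets. -/
structure IsFinitelySuslineanContinuum (X : Type*) [MetricSpace X] : Prop where
  compactSpace : CompactSpace X
  connectedSpace : ConnectedSpace X
  null_of_disjoint : ∀ 𝒜 : Set (Set X), (∀ A ∈ 𝒜, IsSubcontinuum A) →
    𝒜.PairwiseDisjoint id → IsNullFamily (fun A : 𝒜 => (A : Set X))

/-- A minimal set of `f`: nonempty, closed, forward invariant, with no proper subset having these
properties. -/
def IsMinimalSet {X : Type*} [TopologicalSpace X] (f : X → X) (M : Set X) : Prop :=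
  M.Nonempty ∧ IsClosed M ∧ Set.MapsTo f M M ∧
    ∀ N ⊆ M, N.Nonempty → IsClosed N → Set.MapsTo f N N → N = M

/-- A map `f : X → X` is minimal if the whole space is a minimal set of `f`. -/
def IsMinimalMap {X : Type*} [TopologicalSpace X] (f : X → X) : Prop :=
  IsMinimalSet f Set.univ

/-- Topological transitivity: any nonempty open `U`, `V` satisfy `f ^ n (U) ∩ V ≠ ∅` for some
positive integer `n`. -/
def IsTransitiveMap {X : Type*} [TopologicalSpace X] (f : X → X) : Prop :=
  ∀ U V : Set X, IsOpen U → U.Nonempty → IsOpen V → V.Nonempty →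
    ∃ n : ℕ, 0 < n ∧ (f^[n] '' U ∩ V).Nonempty

/-- Topological weak mixing: the product map `f × f` on `X × X` is transitive. -/
def IsWeaklyMixingMap {X : Type*} [TopologicalSpace X] (f : X → X) : Prop :=
  IsTransitiveMap (Prod.map f f)

/-! Suppose `f` is weakly mixing, and call two points equivalent if they share a continuum whose
iterated images have diameters tending to zero. If a continuum does not shrink in this way, finite
suslineanity makes two of its images meet (`exists_iterate_eq`), whereas each iterate of a minimal
map moves all points by a definite distance. Weak mixing then forces every continuum with uniformly
small images to shrink (`isAsymptoticSet_of_diam_le`), and so the classes are themselves shrinking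
continua.

Collapsing the classes gives a nondegenerate metrizable monotone factor that is again finitely
suslinean, minimal and weakly mixing. Minimality provides a nondegenerate continuum with small
images in the factor (`exists_nontrivial_diam_le`): otherwise continua would grow so uniformly that
some orbit could be steered clear of a ball. This continuum shrinks, so does its preimage, and the
preimage lies in a single class: a contradiction. -/

open Set Filter Topology Metric

/-! ### Minimal maps and their iterates -/

namespace IsMinimalMap

variable {X : Type*} [TopologicalSpace X] {f : X → X}

theorem eq_univ (hmin : IsMinimalMap f) {N : Set X} (hne : N.Nonempty) (hcl : IsClosed N)
    (hN : MapsTo f N N) : N = univ :=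
  hmin.2.2.2 N (subset_univ N) hne hcl hN

theorem dense_of_mapsTo (hmin : IsMinimalMap f) (hf : Continuous f) {D : Set X}
    (hne : D.Nonempty) (hD : MapsTo f D D) : Dense D :=
  dense_iff_closure_eq.2 (hmin.eq_univ hne.closure isClosed_closure (hD.closure hf))

theorem surjective [CompactSpace X] [T2Space X] (hmin : IsMinimalMap f) (hf : Continuous f) :
    Function.Surjective f := by
  obtain ⟨x, -⟩ := hmin.1
  exact range_eq_univ.1 (hmin.eq_univ ⟨f x, mem_range_self x⟩ (isCompact_range hf).isClosed
    fun y _ => mem_range_self y)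

theorem iterate_ne [ConnectedSpace X] [T1Space X] [Nontrivial X] (hmin : IsMinimalMap f)
    {k : ℕ} (hk : 0 < k) (v : X) : f^[k] v ≠ v := by
  intro hv
  have hfin : (range fun i : Fin k => f^[i] v).Finite := finite_range _
  have huniv : (range fun i : Fin k => f^[i] v) = univ := by
    refine hmin.eq_univ ⟨_, mem_range_self ⟨0, hk⟩⟩ hfin.isClosed ?_
    rintro _ ⟨⟨i, hi⟩, rfl⟩
    simp only [← Function.iterate_succ_apply' f i v]
    rcases Nat.lt_or_ge (i + 1) k with h | h
    · exact ⟨⟨i + 1, h⟩, rfl⟩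
    · obtain rfl : i + 1 = k := by omega
      exact ⟨⟨0, hk⟩, hv.symm⟩
  have : Infinite X := PreconnectedSpace.infinite
  exact infinite_univ (huniv ▸ hfin)

/-- Iterates of a minimal map of a compact connected Hausdorff space are minimal. -/
theorem iterate [CompactSpace X] [ConnectedSpace X] [T2Space X] (hmin : IsMinimalMap f)
    (hf : Continuous f) {M : ℕ} (hM : 0 < M) : IsMinimalMap f^[M] := by
  refine ⟨univ_nonempty, isClosed_univ, mapsTo_univ _ _, fun N _ hne hcl hN => ?_⟩
  let S : Set (Set X) := {A | A.Nonempty ∧ IsClosed A ∧ MapsTo f^[M] A A}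
  -- `A` is minimal in `S`, so it contains each `f^[i] '' A` that it meets. The finitely many images
  -- with `i < M` cover `X`; those disjoint from `A` form its complement, so `A` is clopen.
  obtain ⟨A, hAN, hA⟩ := zorn_superset_nonempty S (by
    intro c hc hchain hcne
    refine ⟨⋂₀ c, ⟨?_, isClosed_sInter fun s hs => (hc hs).2.1, ?_⟩,
      fun s hs => sInter_subset_of_mem hs⟩
    · have : Nonempty c := hcne.to_subtype
      rw [sInter_eq_iInter]
      refine IsCompact.nonempty_iInter_of_directed_nonempty_isCompact_isClosed _ ?_
        (fun s => (hc s.2).1) (fun s => (hc s.2).2.1.isCompact) fun s => (hc s.2).2.1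
      rintro ⟨s, hs⟩ ⟨t, ht⟩
      rcases hchain.total hs ht with h | h
      · exact ⟨⟨s, hs⟩, subset_rfl, h⟩
      · exact ⟨⟨t, ht⟩, h, subset_rfl⟩
    · exact fun x hx s hs => (hc hs).2.2 (hx s hs)) N ⟨hne, hcl, hN⟩
  obtain ⟨⟨hAne, hAcl, hAM⟩, hAmin⟩ := hA
  have hfi : ∀ i, Continuous f^[i] := fun i => hf.iterate i
  have hcomm : ∀ i j x, f^[i] (f^[j] x) = f^[j] (f^[i] x) := fun i j x =>
    (Function.iterate_add_apply f i j x).symm.trans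
      ((congrArg (fun n => f^[n] x) (add_comm i j)).trans (Function.iterate_add_apply f j i x))
  have hmem : ∀ i, f^[i] '' A ∈ S := fun i =>
    ⟨hAne.image _, (hAcl.isCompact.image (hfi i)).isClosed, by
      rintro _ ⟨x, hx, rfl⟩
      exact ⟨f^[M] x, hAM hx, hcomm _ _ _⟩⟩
  have hsub : ∀ i, (A ∩ f^[i] '' A).Nonempty → f^[i] '' A ⊆ A := by
    rintro i ⟨_, hxA, x, hx, rfl⟩
    have hmemS : A ∩ f^[i] ⁻¹' A ∈ S :=
      ⟨⟨x, hx, hxA⟩, hAcl.inter (hAcl.preimage (hfi i)), fun y hy =>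
        ⟨hAM hy.1, by
          rw [mem_preimage, hcomm]
          exact hAM hy.2⟩⟩
    exact image_subset_iff.2 ((hAmin hmemS inter_subset_left).trans inter_subset_right)
  have hcover : (⋃ i : Fin M, f^[i] '' A) = univ := by
    refine hmin.eq_univ ?_ (isClosed_iUnion_of_finite fun i => (hmem i).2.1) ?_
    · exact (hAne.image f^[0]).mono (subset_iUnion (fun i : Fin M => f^[i] '' A) ⟨0, hM⟩)
    · intro y hy
      obtain ⟨⟨i, hi⟩, x, hx, rfl⟩ := mem_iUnion.1 hy
      simp only [← Function.iterate_succ_apply' f i x]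
      rcases Nat.lt_or_ge (i + 1) M with h | h
      · exact mem_iUnion.2 ⟨⟨i + 1, h⟩, x, hx, rfl⟩
      · obtain rfl : i + 1 = M := by omega
        exact mem_iUnion.2 ⟨⟨0, hM⟩, f^[i + 1] x, hAM hx, rfl⟩
  have hclopen : IsClopen A := by
    refine ⟨hAcl, isClosed_compl_iff.1 ?_⟩
    have : Aᶜ = ⋃ i : {i : Fin M // Disjoint A (f^[i] '' A)}, f^[i.1] '' A := by
      ext y
      constructor
      · intro hy
        obtain ⟨i, hi⟩ := mem_iUnion.1 (hcover.ge (mem_univ y))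
        refine mem_iUnion.2 ⟨⟨i, ?_⟩, hi⟩
        by_contra hdis
        exact hy (hsub i (not_disjoint_iff_nonempty_inter.1 hdis) hi)
      · intro hy hyA
        obtain ⟨⟨i, hi⟩, hyi⟩ := mem_iUnion.1 hy
        exact disjoint_left.1 hi hyA hyi
    rw [this]
    exact isClosed_iUnion_of_finite fun i => (hmem i.1).2.1
  have hAu : A = univ := hclopen.eq_univ hAne
  exact univ_subset_iff.1 (hAu ▸ hAN)

/-- Iterates of a minimal map of a nondegenerate continuum move every point by a definite
distance. -/
theorem exists_pos_le_dist_iterate {X : Type*} [MetricSpace X] [CompactSpace X]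
    [ConnectedSpace X] [Nontrivial X] {f : X → X} (hmin : IsMinimalMap f) (hf : Continuous f)
    {k : ℕ} (hk : 0 < k) : ∃ δ > 0, ∀ w, δ ≤ dist w (f^[k] w) := by
  obtain ⟨w, -, hw⟩ := isCompact_univ.exists_isMinOn (univ_nonempty (α := X))
    (continuous_id.dist (hf.iterate k)).continuousOn
  exact ⟨_, dist_pos.2 (hmin.iterate_ne hk w).symm, fun v => hw (mem_univ v)⟩

end IsMinimalMap

/-- Sensitivity with a constant independent of `U`: the form in which weak mixing is used. -/
theorem IsWeaklyMixingMap.exists_lt_dist {X : Type*} [MetricSpace X] {f : X → X}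
    (hwm : IsWeaklyMixingMap f) {U : Set X} (hU : IsOpen U) (hne : U.Nonempty) {r : ℝ} {p q : X}
    (hr : r < dist p q) : ∃ m, ∃ x ∈ U, ∃ y ∈ U, r < dist (f^[m] x) (f^[m] y) := by
  obtain ⟨m, -, _, ⟨⟨x, y⟩, hxy, rfl⟩, hV⟩ := hwm (U ×ˢ U) {z | r < dist z.1 z.2} (hU.prod hU)
    (hne.prod hne) (isOpen_lt continuous_const continuous_dist) ⟨(p, q), hr⟩
  refine ⟨m, x, hxy.1, y, hxy.2, ?_⟩
  simpa [Prod.map_iterate] using hV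

theorem IsSubcontinuum.image {X Y : Type*} [TopologicalSpace X] [TopologicalSpace Y] {K : Set X}
    (hK : IsSubcontinuum K) {g : X → Y} (hg : Continuous g) : IsSubcontinuum (g '' K) :=
  ⟨hK.1.image hg, hK.2.image g hg.continuousOn⟩

theorem IsFinitelySuslineanContinuum.finite_setOf_le_diam {X : Type*} [MetricSpace X]
    (hX : IsFinitelySuslineanContinuum X) {ι : Type*} {K : ι → Set X}
    (hK : ∀ i, IsSubcontinuum (K i)) (hd : Pairwise fun i j => Disjoint (K i) (K j)) {ε : ℝ}
    (hε : 0 < ε) : {i | ε ≤ diam (K i)}.Finite := by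
  have hinj : Function.Injective fun i => (⟨K i, mem_range_self i⟩ : range K) := by
    intro i j hij
    by_contra hne
    have h : Disjoint (K i) (K j) := hd hne
    rw [show K i = K j from congrArg Subtype.val hij, disjoint_self] at h
    exact (hK j).2.nonempty.ne_empty h
  obtain ⟨J, hJ⟩ := hX.null_of_disjoint (range K) (by rintro _ ⟨i, rfl⟩; exact hK i)
    (by
      rintro _ ⟨i, rfl⟩ _ ⟨j, rfl⟩ hij
      exact hd fun h => hij (h ▸ rfl)) ε hε
  refine (J.finite_toSet.preimage hinj.injOn).subset fun i hi => ?_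
  by_contra hiJ
  exact absurd (hJ _ hiJ) (not_lt.2 hi)

/-- A set is asymptotic under `f` if the diameters of its iterated images tend to zero. -/
def IsAsymptoticSet {X : Type*} [MetricSpace X] (f : X → X) (K : Set X) : Prop :=
  Tendsto (fun n => diam (f^[n] '' K)) atTop (𝓝 0)

theorem isAsymptoticSet_of_forall_not_frequently {X : Type*} [MetricSpace X] {f : X → X}
    {K : Set X} (h : ∀ ε > 0, ¬ ∃ᶠ n in atTop, ε ≤ diam (f^[n] '' K)) : IsAsymptoticSet f K := by
  refine tendsto_order.2 ⟨fun a ha => Eventually.of_forall fun n => ha.trans_le diam_nonneg,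
    fun a ha => ?_⟩
  filter_upwards [not_frequently.1 (h a ha)] with n hn using not_le.1 hn

theorem dist_le_diam_image {X Y : Type*} [MetricSpace Y] [CompactSpace Y] {K : Set X}
    {x y : X} (hx : x ∈ K) (hy : y ∈ K) (g : X → Y) : dist (g x) (g y) ≤ diam (g '' K) :=
  dist_le_diam_of_mem isBounded_of_compactSpace (mem_image_of_mem g hx) (mem_image_of_mem g hy)

theorem image_iterate_image {X : Type*} (f : X → X) (m n : ℕ) (K : Set X) :
    f^[m] '' (f^[n] '' K) = f^[m + n] '' K := by
  rw [← image_comp, ← Function.iterate_add]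

/-! ### Stable continua are asymptotic -/

namespace IsFinitelySuslineanContinuum

variable {X : Type*} [MetricSpace X] {f : X → X}

/-- Infinitely many large images cannot be pairwise disjoint, and a coincidence of orbits at one
time persists at all later times. -/
theorem exists_iterate_eq (hX : IsFinitelySuslineanContinuum X) (hf : Continuous f) {L : Set X}
    (hL : IsSubcontinuum L) {δ : ℝ} (hδ : 0 < δ)
    (hfreq : ∃ᶠ n in atTop, δ ≤ diam (f^[n] '' L)) :
    ∃ n k, 0 < k ∧ ∃ a ∈ L, ∃ b ∈ L, ∀ j ≥ n, f^[k] (f^[j] b) = f^[j] a := by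
  by_contra! hcon
  have key : ∀ n m, n < m → Disjoint (f^[n] '' L) (f^[m] '' L) := by
    intro n m hnm
    rw [Set.disjoint_left]
    rintro _ ⟨a, ha, rfl⟩ ⟨b, hb, hab⟩
    obtain ⟨k, rfl⟩ := Nat.exists_eq_add_of_lt hnm
    obtain ⟨j, hj, hne⟩ := hcon n (k + 1) k.succ_pos a ha b hb
    obtain ⟨i, rfl⟩ := Nat.exists_eq_add_of_le hj
    refine hne ?_
    rw [add_comm n i, Function.iterate_add_apply f i n a, ← hab, ← Function.iterate_add_apply,
      ← Function.iterate_add_apply]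
    exact congrArg (fun t => f^[t] b) (by omega)
  refine (Nat.frequently_atTop_iff_infinite.1 hfreq) (hX.finite_setOf_le_diam
    (fun n => hL.image (hf.iterate n)) (fun n m hnm => ?_) hδ)
  rcases lt_or_gt_of_ne hnm with h | h
  · exact key n m h
  · exact (key m n h).symm

/-- Under a minimal weakly mixing map, a subcontinuum whose iterated images stay small does not
have iterated images of diameter bounded from below. -/
theorem exists_diam_iterate_lt (hX : IsFinitelySuslineanContinuum X) (hf : Continuous f)
    (hmin : IsMinimalMap f) (hwm : IsWeaklyMixingMap f) {c : ℝ} {p q : X} (hc : 3 * c < dist p q)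
    {L : Set X} (hL : IsSubcontinuum L) (hLc : ∀ n, diam (f^[n] '' L) ≤ c) {δ : ℝ} (hδ : 0 < δ) :
    ∃ n, diam (f^[n] '' L) < δ := by
  by_contra! hLδ
  have := hX.compactSpace
  have hK : ∀ n, IsSubcontinuum (f^[n] '' L) := fun n => hL.image (hf.iterate n)
  -- With size function zero this only yields a disjoint subfamily that every image meets.
  obtain ⟨I, -, hI, hmeet⟩ := Vitali.exists_disjoint_subfamily_covering_enlargement
    (fun n => f^[n] '' L) univ (fun _ => 0) 2 one_lt_two (fun _ _ => le_rfl) 0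
    (fun _ _ => le_rfl) (fun n _ => (hK n).2.nonempty)
  have hIfin : Finite I := by
    have h := hX.finite_setOf_le_diam (K := fun i : I => f^[i] '' L) (fun i => hK i)
      (fun i j hij => hI i.2 j.2 fun h => hij (Subtype.ext h)) hδ
    exact finite_univ_iff.1 (h.subset fun i _ => hLδ i)
  -- Two points of a star are joined by a chain of three images of `L`, whence the bound `3 * c` at
  -- all times. The closures of the finitely many stars cover `X`, so one has interior, against
  -- sensitivity.
  let St : I → Set X := fun a => ⋃ n ∈ {n | (f^[n] '' L ∩ f^[a] '' L).Nonempty}, f^[n] '' L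
  have hdiam : ∀ a m, diam (f^[m] '' closure (St a)) ≤ 3 * c := by
    intro a m
    refine (diam_mono (image_closure_subset_closure_image (hf.iterate m))
      isBounded_of_compactSpace).trans ?_
    rw [diam_closure]
    have hc0 : 0 ≤ c := diam_nonneg.trans (hLc 0)
    refine diam_le_of_forall_dist_le (by positivity) ?_
    rintro _ ⟨x, hx, rfl⟩ _ ⟨y, hy, rfl⟩
    have hsmall : ∀ n, ∀ u ∈ f^[n] '' L, ∀ v ∈ f^[n] '' L, dist (f^[m] u) (f^[m] v) ≤ c := by
      intro n u hu v hv
      refine (dist_le_diam_image hu hv _).trans ?_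
      rw [image_iterate_image]
      exact hLc _
    simp only [St, mem_iUnion, mem_ofPred_eq] at hx hy
    obtain ⟨i, ⟨u, hui, hua⟩, hxi⟩ := hx
    obtain ⟨j, ⟨v, hvj, hva⟩, hyj⟩ := hy
    have h1 := hsmall _ _ hxi _ hui
    have h2 := hsmall _ _ hua _ hva
    have h3 := hsmall _ _ hvj _ hyj
    have h4 := dist_triangle4 (f^[m] x) (f^[m] u) (f^[m] v) (f^[m] y)
    linarith
  have hdense : Dense (⋃ n, f^[n] '' L) := by
    refine hmin.dense_of_mapsTo hf ((hK 0).2.nonempty.mono (subset_iUnion _ 0)) fun x hx => ?_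
    obtain ⟨n, a, ha, rfl⟩ := mem_iUnion.1 hx
    exact mem_iUnion.2 ⟨n + 1, a, ha, Function.iterate_succ_apply' f n a⟩
  have hcover : ⋃ a, closure (St a) = univ := by
    refine univ_subset_iff.1 (hdense.closure_eq.symm.trans_subset
      (closure_minimal (iUnion_subset fun n x hx => ?_)
        (isClosed_iUnion_of_finite fun a => isClosed_closure)))
    obtain ⟨a, ha, hne, -⟩ := hmeet n (mem_univ n)
    exact mem_iUnion.2 ⟨⟨a, ha⟩, subset_closure (mem_iUnion₂.2 ⟨n, hne, hx⟩)⟩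
  have : Nonempty X := ⟨p⟩
  obtain ⟨a, ha⟩ := nonempty_interior_of_iUnion_of_closed (fun a => isClosed_closure) hcover
  obtain ⟨m, x, hx, y, hy, hxy⟩ := hwm.exists_lt_dist isOpen_interior ha hc
  exact absurd (hxy.trans_le (dist_le_diam_image (interior_subset hx) (interior_subset hy) _))
    (not_lt.2 (hdiam a m))

/-- Under a minimal weakly mixing map of a finitely suslinean continuum, a subcontinuum whose
iterated images stay small is asymptotic. -/
theorem isAsymptoticSet_of_diam_le (hX : IsFinitelySuslineanContinuum X) (hf : Continuous f)
    (hmin : IsMinimalMap f) (hwm : IsWeaklyMixingMap f) {c : ℝ} {p q : X} (hpq : p ≠ q)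
    (hc : 3 * c < dist p q) {L : Set X} (hL : IsSubcontinuum L)
    (hLc : ∀ n, diam (f^[n] '' L) ≤ c) : IsAsymptoticSet f L := by
  have := hX.compactSpace
  have := hX.connectedSpace
  have : Nontrivial X := ⟨p, q, hpq⟩
  refine isAsymptoticSet_of_forall_not_frequently fun ε hε hfreq => ?_
  obtain ⟨n, k, hk, a, ha, b, hb, hab⟩ := hX.exists_iterate_eq hf hL hε hfreq
  obtain ⟨δ, hδ, hdisp⟩ := hmin.exists_pos_le_dist_iterate hf hk
  obtain ⟨m, hm⟩ := hX.exists_diam_iterate_lt hf hmin hwm hc (hL.image (hf.iterate n))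
    (fun m => by rw [image_iterate_image]; exact hLc _) hδ
  rw [image_iterate_image] at hm
  -- The image at time `m + n` contains both `f^[m + n] b` and its `f^[k]`-image, which is `f^[m +
  -- n] a`.
  refine absurd ((hdisp (f^[m + n] b)).trans ?_) (not_le.2 hm)
  rw [hab _ (Nat.le_add_left n m)]
  exact dist_le_diam_image hb ha _

end IsFinitelySuslineanContinuum

/-! ### Boundary bumping and limits of continua -/

/-- Boundary bumping: a continuum that leaves a closed ball around one of its points contains a
continuum inside that ball joining the centre to the boundary. -/
theorem IsSubcontinuum.exists_subset_closedBall {X : Type*} [MetricSpace X] {L : Set X}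
    (hL : IsSubcontinuum L) {a : X} (ha : a ∈ L) {s : ℝ} (hs : 0 < s)
    (hLs : ¬ L ⊆ closedBall a s) :
    ∃ K ⊆ L ∩ closedBall a s, IsSubcontinuum K ∧ s ≤ diam K := by
  have hZ : IsCompact (L ∩ closedBall a s) := hL.1.inter_right isClosed_closedBall
  have haZ : a ∈ L ∩ closedBall a s := ⟨ha, mem_closedBall_self hs.le⟩
  generalize hZdef : L ∩ closedBall a s = Z at hZ haZ
  have : CompactSpace Z := isCompact_iff_compactSpace.1 hZ
  let a' : Z := ⟨a, haZ⟩
  have hK : IsSubcontinuum ((↑) '' connectedComponent a' : Set X) :=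
    IsSubcontinuum.image ⟨isClosed_connectedComponent.isCompact, isConnected_connectedComponent⟩
      continuous_subtype_val
  have hKZ : ((↑) '' connectedComponent a' : Set X) ⊆ Z := by
    rintro _ ⟨x, -, rfl⟩
    exact x.2
  refine ⟨_, hKZ, hK, ?_⟩
  by_contra! hlt
  have hball : ∀ x ∈ connectedComponent a', dist (x : X) a < s := fun x hx =>
    (dist_le_diam_of_mem hK.1.isBounded (mem_image_of_mem _ hx)
      (mem_image_of_mem _ (mem_connectedComponent (x := a')))).trans_lt hlt
  have hopen : IsOpen {x : Z | dist (x : X) a < s} :=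
    isOpen_lt (continuous_subtype_val.dist continuous_const) continuous_const
  -- The component is an intersection of clopen subsets of `Z`, so one such `C` lies in the open
  -- ball. It is then separated in `L` from the rest, against connectedness.
  rw [connectedComponent_eq_iInter_isClopen] at hball
  have : Nonempty {C : Set Z // IsClopen C ∧ a' ∈ C} := ⟨⟨univ, isClopen_univ, mem_univ _⟩⟩
  obtain ⟨⟨C, hC, haC⟩, hCs⟩ := exists_subset_nhds_of_compactSpace
    (V := fun C : {C : Set Z // IsClopen C ∧ a' ∈ C} => (C : Set Z))
    (fun C D => ⟨⟨C ∩ D, C.2.1.inter D.2.1, C.2.2, D.2.2⟩, inter_subset_left,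
      inter_subset_right⟩) (fun C => C.2.1.1) (fun x hx => hopen.mem_nhds (hball x hx))
  have hcl : ∀ D : Set Z, IsClosed D → IsClosed ((↑) '' D : Set X) := fun D hD =>
    (hD.isCompact.image continuous_subtype_val).isClosed
  obtain ⟨b, hbL, hb⟩ := not_subset.1 hLs
  rw [mem_closedBall, not_le] at hb
  obtain ⟨x, -, ⟨y, hy, rfl⟩, hx⟩ := isPreconnected_closed_iff.1 hL.2.isPreconnected
    ((↑) '' C) ((↑) '' Cᶜ ∪ (ball a s)ᶜ) (hcl C hC.1)
    ((hcl _ hC.compl.1).union isOpen_ball.isClosed_compl)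
    (by
      intro x hx
      by_cases hxs : x ∈ ball a s
      · have hxZ : x ∈ Z := hZdef ▸ ⟨hx, ball_subset_closedBall hxs⟩
        by_cases hxC : (⟨x, hxZ⟩ : Z) ∈ C
        · exact Or.inl ⟨_, hxC, rfl⟩
        · exact Or.inr (Or.inl ⟨_, hxC, rfl⟩)
      · exact Or.inr (Or.inr hxs))
    ⟨a, ha, a', haC, rfl⟩ ⟨b, hbL, Or.inr fun h => hb.not_gt h⟩
  rcases hx with ⟨z, hz, hzy⟩ | hx
  · exact hz (Subtype.ext hzy ▸ hy)
  · exact hx (hCs hy)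

theorem IsSubcontinuum.exists_subset_diam_le {X : Type*} [MetricSpace X] {K : Set X}
    (hK : IsSubcontinuum K) {s : ℝ} (hs : 0 < s) (hKs : s ≤ diam K) :
    ∃ K' ⊆ K, IsSubcontinuum K' ∧ s ≤ diam K' ∧ diam K' ≤ 2 * s := by
  obtain ⟨a, ha⟩ := hK.2.nonempty
  by_cases h : K ⊆ closedBall a s
  · exact ⟨K, subset_rfl, hK, hKs, (diam_mono h isBounded_closedBall).trans
      (diam_closedBall hs.le)⟩
  · obtain ⟨K', hK'K, hK', hs'⟩ := hK.exists_subset_closedBall ha hs h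
    exact ⟨K', hK'K.trans inter_subset_left, hK', hs',
      (diam_mono (hK'K.trans inter_subset_right) isBounded_closedBall).trans
        (diam_closedBall hs.le)⟩

/-- The topological upper limit of a sequence of connected sets in a compact space is connected if
the sets contain the terms of a convergent sequence. -/
theorem isConnected_iInter_closure_iUnion {X : Type*} [TopologicalSpace X] [CompactSpace X]
    [T2Space X] {K : ℕ → Set X} (hK : ∀ n, IsConnected (K n)) {u : ℕ → X} (hu : ∀ n, u n ∈ K n)
    {a : X} (ha : Tendsto u atTop (𝓝 a)) :
    a ∈ (⋂ N, closure (⋃ n ≥ N, K n)) ∧ IsConnected (⋂ N, closure (⋃ n ≥ N, K n)) := by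
  have hmem : a ∈ ⋂ N, closure (⋃ n ≥ N, K n) := by
    refine mem_iInter.2 fun N => mem_closure_of_tendsto ha ?_
    filter_upwards [eventually_ge_atTop N] with n hn using mem_iUnion₂.2 ⟨n, hn, hu n⟩
  have hclosed : IsClosed (⋂ N, closure (⋃ n ≥ N, K n)) :=
    isClosed_iInter fun N => isClosed_closure
  -- Late `K n` lie in `U ∪ V` and meet `U` near `a`, so by connectedness they lie in `U` and
  -- nothing accumulates in `v`.
  have key : ∀ u v : Set X, IsClosed u → IsClosed v →
      (⋂ N, closure (⋃ n ≥ N, K n)) ⊆ u ∪ v → Disjoint u v → a ∈ u →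
      (⋂ N, closure (⋃ n ≥ N, K n)) ⊆ u := by
    intro u v hu' hv hsub hdis hau
    obtain ⟨U, V, hU, hV, huU, hvV, hUV⟩ := normal_separation hu' hv hdis
    obtain ⟨N, hN⟩ := exists_subset_nhds_of_compactSpace
      (V := fun N => closure (⋃ n ≥ N, K n)) (U := U ∪ V)
      (directed_of_isDirected_le fun N N' h => closure_mono
        (biUnion_subset_biUnion_left fun n hn => le_trans h hn))
      (fun N => isClosed_closure)
      fun x hx => (hU.union hV).mem_nhds ((hsub hx).imp (@huU x) (@hvV x))
    have hKU : ∀ᶠ n in atTop, K n ⊆ U := by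
      filter_upwards [ha.eventually (hU.mem_nhds (huU hau)), eventually_ge_atTop N] with n hn hnN
      exact (hK n).isPreconnected.subset_left_of_subset_union hU hV hUV
        ((subset_closure.trans' (subset_biUnion_of_mem (u := K) hnN)).trans hN) ⟨_, hu n, hn⟩
    obtain ⟨N', hN'⟩ := eventually_atTop.1 hKU
    intro x hx
    refine (hsub hx).resolve_right fun hxv => ?_
    obtain ⟨y, hyV, hy⟩ := mem_closure_iff.1 (mem_iInter.1 hx N') V hV (hvV hxv)
    obtain ⟨n, hn, hyn⟩ := mem_iUnion₂.1 hy
    exact disjoint_left.1 hUV (hN' n hn hyn) hyV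
  refine ⟨hmem, ⟨a, hmem⟩, (isPreconnected_iff_subset_of_fully_disjoint_closed hclosed).2 ?_⟩
  intro u v hu' hv hsub hdis
  rcases hsub hmem with h | h
  · exact Or.inl (key u v hu' hv hsub hdis h)
  · exact Or.inr (key v u hv hu' (union_comm u v ▸ hsub) hdis.symm h)

/-! ### Minimal maps are not continuum-wise expansive -/

section Expansive

variable {X : Type*} [MetricSpace X] [CompactSpace X] {f : X → X}

/-- If every continuum with small iterated images is degenerate, then continua of a given size grow
within a bounded time. -/
theorem exists_forall_exists_le_lt_diam (hf : Continuous f) {c : ℝ}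
    (hexp : ∀ K, IsSubcontinuum K → (∀ n, diam (f^[n] '' K) ≤ 2 * c) → K.Subsingleton) {δ : ℝ}
    (hδ : 0 < δ) :
    ∃ N, ∀ K, IsSubcontinuum K → δ ≤ diam K → ∃ n ≤ N, c < diam (f^[n] '' K) := by
  -- The upper limit of counterexamples `K n` contains two points at distance at least `δ / 2`. Its
  -- `j`-th image lies in a ball of radius `c` around `f^[j] a`, which is why `hexp` has `2 * c`.
  by_contra! hcon
  choose K hK hKδ hKc using hcon
  have hab : ∀ n, ∃ p : X × X, p.1 ∈ K n ∧ p.2 ∈ K n ∧ δ / 2 ≤ dist p.1 p.2 := by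
    intro n
    by_contra! h
    have := diam_le_of_forall_dist_le (half_pos hδ).le fun x hx y hy => (h (x, y) hx hy).le
    linarith [hKδ n]
  choose p hp₁ hp₂ hp using hab
  obtain ⟨⟨a, b⟩, φ, hφ, hlim⟩ := CompactSpace.tendsto_subseq p
  have hlim₁ : Tendsto (fun n => (p (φ n)).1) atTop (𝓝 a) := hlim.fst_nhds
  have hlim₂ : Tendsto (fun n => (p (φ n)).2) atTop (𝓝 b) := hlim.snd_nhds
  obtain ⟨haE, hE⟩ := isConnected_iInter_closure_iUnion (fun n => (hK (φ n)).2)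
    (fun n => hp₁ (φ n)) hlim₁
  have hbE := (isConnected_iInter_closure_iUnion (fun n => (hK (φ n)).2)
    (fun n => hp₂ (φ n)) hlim₂).1
  have hEc : IsCompact (⋂ N, closure (⋃ n ≥ N, K (φ n))) :=
    (isClosed_iInter fun N => isClosed_closure).isCompact
  have hc : 0 ≤ c := diam_nonneg.trans (hKc 0 0 le_rfl)
  have hsub := hexp _ ⟨hEc, hE⟩ fun j => by
    refine (diam_mono (t := closedBall (f^[j] a) c) ?_ isBounded_closedBall).trans
      (diam_closedBall hc)
    rintro _ ⟨x, hx, rfl⟩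
    refine mem_closedBall.2 (le_of_forall_pos_le_add fun ε hε => ?_)
    have hcl : IsClosed {z | dist (f^[j] z) (f^[j] a) ≤ c + ε} :=
      isClosed_le ((hf.iterate j).dist continuous_const) continuous_const
    have hev : ∀ᶠ n in atTop, K (φ n) ⊆ {z | dist (f^[j] z) (f^[j] a) ≤ c + ε} := by
      filter_upwards [(((hf.iterate j).tendsto a).comp hlim₁).eventually (ball_mem_nhds _ hε),
        eventually_ge_atTop j] with n hn hjn z hz
      have h1 := (dist_le_diam_image hz (hp₁ (φ n)) f^[j]).trans
        (hKc (φ n) j (hjn.trans (hφ.id_le n)))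
      have h2 : dist (f^[j] (p (φ n)).1) (f^[j] a) < ε := hn
      exact (dist_triangle _ (f^[j] (p (φ n)).1) _).trans (add_le_add h1 h2.le)
    obtain ⟨N, hN⟩ := eventually_atTop.1 hev
    exact closure_minimal (iUnion₂_subset hN) hcl (mem_iInter.1 hx N)
  have hdist : δ / 2 ≤ dist a b :=
    ge_of_tendsto (hlim₁.dist hlim₂) (Eventually.of_forall fun n => hp (φ n))
  rw [hsub haE hbE, dist_self] at hdist
  linarith

/-- If every continuum with small iterated images is degenerate, then the iterated images of large
continua stay large. -/
theorem exists_pos_forall_le_diam_iterate (hf : Continuous f) {s : ℝ} (hs : 0 < s)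
    (hexp : ∀ K, IsSubcontinuum K → (∀ n, diam (f^[n] '' K) ≤ 2 * (2 * s)) → K.Subsingleton) :
    ∃ δ > 0, ∀ n K, IsSubcontinuum K → s ≤ diam K → δ ≤ diam (f^[n] '' K) := by
  obtain ⟨N, hN⟩ := exists_forall_exists_le_lt_diam hf hexp hs
  have huc : ∀ᶠ q in uniformity X, ∀ j ∈ Iic N, dist (f^[j] q.1) (f^[j] q.2) < 2 * s :=
    ((finite_Iic N).eventually_all).2 fun j _ =>
      (CompactSpace.uniformContinuous_of_continuous (hf.iterate j))
        (dist_mem_uniformity (by positivity : 0 < 2 * s))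
  obtain ⟨δ, hδ, hδN⟩ := mem_uniformity_dist.1 huc
  refine ⟨δ, hδ, fun n => ?_⟩
  induction n using Nat.strong_induction_on with
  | _ n ih =>
    intro K hK hKs
    -- Trimming to diameter at most `2 * s` makes the growth time `m` positive. If `m < n`,
    -- induction restarts at time `m`; otherwise an image of diameter below `δ` at time `n` could
    -- not exceed `2 * s` at time `m`.
    obtain ⟨K', hK'K, hK', hsK', hK's⟩ := hK.exists_subset_diam_le hs hKs
    obtain ⟨m, hmN, hm⟩ := hN K' hK' hsK'
    refine le_trans ?_ (diam_mono (image_mono hK'K) isBounded_of_compactSpace)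
    rcases lt_or_ge m n with hmn | hmn
    · obtain ⟨k, rfl⟩ := Nat.exists_eq_add_of_le' hmn.le
      rw [← image_iterate_image]
      refine ih k ?_ _ (hK'.image (hf.iterate m)) (by linarith)
      have : m ≠ 0 := by
        rintro rfl
        rw [Function.iterate_zero, image_id] at hm
        exact hm.not_ge hK's
      omega
    · obtain ⟨k, rfl⟩ := Nat.exists_eq_add_of_le' hmn
      by_contra! hlt
      refine hm.not_ge (diam_le_of_forall_dist_le (by positivity) ?_)
      rw [← image_iterate_image]
      rintro _ ⟨x, hx, rfl⟩ _ ⟨y, hy, rfl⟩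
      exact (hδN ((dist_le_diam_of_mem isBounded_of_compactSpace hx hy).trans_lt hlt) k
        (le_of_add_le_left hmN)).le

/-- A minimal map of a nondegenerate continuum has nondegenerate subcontinua all of whose iterated
images are small. -/
theorem IsMinimalMap.exists_nontrivial_diam_le [ConnectedSpace X] [Nontrivial X]
    (hmin : IsMinimalMap f) (hf : Continuous f) {c : ℝ} (hc : 0 < c) :
    ∃ K, IsSubcontinuum K ∧ (∀ n, diam (f^[n] '' K) ≤ c) ∧ K.Nontrivial := by
  by_contra! hcon
  obtain ⟨s, hs, rfl⟩ : ∃ s > 0, 2 * (2 * s) = c := ⟨c / 4, by positivity, by ring⟩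
  have hexp : ∀ K : Set X, IsSubcontinuum K → (∀ n, diam (f^[n] '' K) ≤ 2 * (2 * s)) →
      K.Subsingleton := hcon
  have huniv : IsSubcontinuum (univ : Set X) := ⟨isCompact_univ, isConnected_univ⟩
  obtain ⟨δ, hδ, hlow⟩ := exists_pos_forall_le_diam_iterate hf hs hexp
  obtain ⟨N, hN⟩ := exists_forall_exists_le_lt_diam hf hexp (δ := δ / 4) (by positivity)
  -- Growth past `2 * s` by time `N`, then persistence. The exponent `N + 1` is positive, so this
  -- iterate is minimal.
  have hgrow : ∀ K, IsSubcontinuum K → δ / 4 ≤ diam K → δ ≤ diam (f^[N + 1] '' K) := by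
    intro K hK hKδ
    obtain ⟨n, hn, hlt⟩ := hN K hK hKδ
    obtain ⟨k, hk⟩ := Nat.exists_eq_add_of_le' (hn.trans N.le_succ)
    rw [show N + 1 = k + n from hk, ← image_iterate_image]
    exact hlow k _ (hK.image (hf.iterate n)) (by linarith)
  have hunivδ : δ / 4 ≤ diam (univ : Set X) := by
    obtain ⟨n, hn⟩ : ∃ n, 2 * (2 * s) < diam (f^[n] '' univ) := by
      by_contra! h
      exact nontrivial_univ.not_subsingleton (hexp univ huniv h)
    have h1 := diam_mono (subset_univ (f^[n] '' univ)) isBounded_of_compactSpace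
    have h2 := hlow 0 univ huniv (by linarith)
    rw [Function.iterate_zero, image_id] at h2
    linarith
  have hg : Continuous f^[N + 1] := hf.iterate _
  have hgmin : IsMinimalMap f^[N + 1] := hmin.iterate hf N.succ_pos
  generalize f^[N + 1] = g at hgrow hg hgmin
  obtain ⟨o, -⟩ := hmin.1
  -- a large continuum has a large subcontinuum of its image avoiding a ball around `o`
  have havoid : ∀ K, IsSubcontinuum K → δ / 4 ≤ diam K →
      ∃ K' ⊆ g '' K, IsSubcontinuum K' ∧ δ / 4 ≤ diam K' ∧ Disjoint K' (ball o (δ / 12)) := by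
    intro K hK hKδ
    have hgK := hgrow K hK hKδ
    have hball : ∀ a r, 0 ≤ r → 2 * r < δ → ¬ g '' K ⊆ closedBall a r := fun a r hr hrδ hsub =>
      absurd ((hgK.trans (diam_mono hsub isBounded_closedBall)).trans (diam_closedBall hr))
        (not_le.2 hrδ)
    -- A continuum within `δ / 4` of `a` misses the ball around `o`, as `δ / 3 - δ / 4 = δ / 12`.
    obtain ⟨a, ha, hao⟩ := not_subset.1 (hball o (δ / 3) (by positivity) (by linarith))
    rw [mem_closedBall, not_le] at hao
    obtain ⟨K', hK'K, hK', hdiam⟩ := (hK.image hg).exists_subset_closedBall ha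
      (by positivity : 0 < δ / 4) (hball a (δ / 4) (by positivity) (by linarith))
    refine ⟨K', hK'K.trans inter_subset_left, hK', hdiam, disjoint_left.2 fun x hx hxo => ?_⟩
    have h1 : dist x a ≤ δ / 4 := (hK'K hx).2
    have h2 : dist x o < δ / 12 := hxo
    have h3 := dist_triangle_left a o x
    linarith
  have hfin : ∀ n K, IsSubcontinuum K → δ / 4 ≤ diam K →
      ∃ z ∈ K, ∀ i < n, g^[i + 1] z ∉ ball o (δ / 12) := by
    intro n
    induction n with
    | zero => exact fun K hK _ => hK.2.nonempty.imp fun z hz => ⟨hz, by simp⟩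
    | succ n ih =>
      intro K hK hKδ
      obtain ⟨K', hK'K, hK', hdiam, hdis⟩ := havoid K hK hKδ
      obtain ⟨w, hw, hwi⟩ := ih K' hK' hdiam
      obtain ⟨z, hz, rfl⟩ := hK'K hw
      refine ⟨z, hz, fun i hi => ?_⟩
      rcases i with _ | i
      · exact disjoint_left.1 hdis hw
      · exact hwi i (Nat.lt_of_succ_lt_succ hi)
  have hclosed : ∀ i, IsClosed {z | g^[i + 1] z ∉ ball o (δ / 12)} := fun i =>
    isOpen_ball.isClosed_compl.preimage (hg.iterate (i + 1))
  -- Compactness turns `hfin` into a point avoiding the ball at all positive times. By minimality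
  -- all points do, yet `o` has a preimage.
  have hinv : (⋂ i, {z | g^[i + 1] z ∉ ball o (δ / 12)}) = univ := by
    refine hgmin.eq_univ ?_ (isClosed_iInter hclosed) fun z hz =>
      mem_iInter.2 fun i => mem_iInter.1 hz (i + 1)
    by_contra hempty
    obtain ⟨t, ht⟩ := isCompact_univ.elim_finite_subfamily_closed _ hclosed
      (by rw [univ_inter, ← not_nonempty_iff_eq_empty]; exact hempty)
    obtain ⟨n, hn⟩ := t.exists_nat_subset_range
    obtain ⟨z, -, hz⟩ := hfin n univ huniv hunivδ
    exact (ht.subset ⟨mem_univ z, mem_iInter₂.2 fun i hi => hz i (Finset.mem_range.1 (hn hi))⟩)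
  obtain ⟨z, hz⟩ := hgmin.surjective hg o
  exact mem_iInter.1 (hinv.ge (mem_univ z)) 0 (by
    rw [Function.iterate_one, hz]
    exact mem_ball_self (by positivity))

end Expansive

/-! ### Quotients by closed maps -/

section ClosedMap

variable {X Y : Type*} [TopologicalSpace X] [TopologicalSpace Y] {π : X → Y}

theorem IsClosedMap.t2Space [NormalSpace X] [T1Space X] (hcl : IsClosedMap π) (hπ : Continuous π)
    (hsurj : Function.Surjective π) : T2Space Y := by
  have hpt : ∀ y : Y, IsClosed ({y} : Set Y) := fun y => by
    obtain ⟨x, rfl⟩ := hsurj y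
    exact image_singleton ▸ hcl _ isClosed_singleton
  refine ⟨fun y z hyz => ?_⟩
  obtain ⟨U, V, hU, hV, hyU, hzV, hUV⟩ := normal_separation ((hpt y).preimage hπ)
    ((hpt z).preimage hπ) (disjoint_singleton.2 hyz |>.preimage π)
  refine ⟨kernImage π U, kernImage π V, isClosedMap_iff_kernImage.1 hcl hU,
    isClosedMap_iff_kernImage.1 hcl hV, fun x hx => hyU hx, fun x hx => hzV hx,
    disjoint_left.2 fun w hwU hwV => ?_⟩
  obtain ⟨x, rfl⟩ := hsurj w
  exact disjoint_left.1 hUV (hwU rfl) (hwV rfl)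

/-- Fibres are compact, so finite unions of basic open sets suffice to surround them. -/
theorem IsClosedMap.secondCountableTopology [CompactSpace X] [SecondCountableTopology X]
    [T1Space Y] (hcl : IsClosedMap π) (hπ : Continuous π) (hsurj : Function.Surjective π) :
    SecondCountableTopology Y := by
  have hb := TopologicalSpace.isBasis_countableBasis X
  refine (TopologicalSpace.isTopologicalBasis_of_isOpen_of_nhds
    (s := (fun t => kernImage π (⋃₀ t)) ''
      {t | t.Finite ∧ t ⊆ TopologicalSpace.countableBasis X}) ?_ ?_).secondCountableTopology
      ((countable_ofPred_finite_subset (TopologicalSpace.countable_countableBasis X)).image _)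
  · rintro _ ⟨t, ht, rfl⟩
    exact isClosedMap_iff_kernImage.1 hcl (isOpen_sUnion fun s hs => hb.isOpen (ht.2 hs))
  · intro y V hy hV
    have hopen : IsOpen (π ⁻¹' V) := hV.preimage hπ
    obtain ⟨t, ht, htf, hcover⟩ := (isClosed_singleton.preimage hπ).isCompact.elim_finite_subcover_image
      (s := π ⁻¹' {y}) (b := {s ∈ TopologicalSpace.countableBasis X | s ⊆ π ⁻¹' V}) (c := id)
      (fun s hs => hb.isOpen hs.1) (fun x hx => by
        obtain ⟨s, hs, hxs, hsV⟩ := hb.exists_subset_of_mem_open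
          (show π x ∈ V by rwa [show π x = y from hx]) hopen
        exact mem_iUnion₂.2 ⟨s, ⟨hs, hsV⟩, hxs⟩)
    refine ⟨_, ⟨t, ⟨htf, fun s hs => (ht hs).1⟩, rfl⟩, fun x hx => ?_, fun z hz => ?_⟩
    · obtain ⟨s, hs, hxs⟩ := mem_iUnion₂.1 (hcover hx)
      exact ⟨s, hs, hxs⟩
    · obtain ⟨x, rfl⟩ := hsurj z
      obtain ⟨s, hs, hxs⟩ := hz rfl
      exact (ht hs).2 hxs

end ClosedMap

/-! ### Asymptotic classes -/

section Asymptotic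

variable {X : Type*} [MetricSpace X] {f : X → X}

theorem IsAsymptoticSet.of_image_iterate {K : Set X} {N : ℕ}
    (h : IsAsymptoticSet f (f^[N] '' K)) : IsAsymptoticSet f K := by
  refine (tendsto_add_atTop_iff_nat N).1 (h.congr fun n => ?_)
  rw [image_iterate_image]

variable (f) in
/-- Two points are asymptotically equivalent if they lie in a common asymptotic continuum. -/
def asymptoticSetoid : Setoid X where
  r x y := ∃ K, IsSubcontinuum K ∧ IsAsymptoticSet f K ∧ x ∈ K ∧ y ∈ K
  iseqv :=
    { refl := fun x => ⟨{x}, ⟨isCompact_singleton, isConnected_singleton⟩, by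
        simp [IsAsymptoticSet], rfl, rfl⟩
      symm := fun ⟨K, hK, hKa, hx, hy⟩ => ⟨K, hK, hKa, hy, hx⟩
      trans := by
        rintro x y z ⟨K, hK, hKa, hx, hy⟩ ⟨L, hL, hLa, hy', hz⟩
        refine ⟨K ∪ L, ⟨hK.1.union hL.1, hK.2.union ⟨y, hy, hy'⟩ hL.2⟩, ?_, Or.inl hx, Or.inr hz⟩
        refine squeeze_zero (fun n => diam_nonneg) (fun n => ?_) (add_zero (0 : ℝ) ▸ hKa.add hLa)
        rw [image_union]
        exact diam_union' ⟨_, mem_image_of_mem _ hy, mem_image_of_mem _ hy'⟩ }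

variable (f) in
/-- The asymptotic class of a point. -/
def asymptoticClass (x : X) : Set X := {y | asymptoticSetoid f x y}

theorem asymptoticSetoid_map (hf : Continuous f) {x y : X} (h : asymptoticSetoid f x y) :
    asymptoticSetoid f (f x) (f y) := by
  obtain ⟨K, hK, hKa, hx, hy⟩ := h
  refine ⟨f '' K, hK.image hf, ?_, mem_image_of_mem f hx, mem_image_of_mem f hy⟩
  refine ((tendsto_add_atTop_iff_nat 1).2 hKa).congr fun n => ?_
  rw [← image_iterate_image, Function.iterate_one]

theorem asymptoticSetoid_iterate (hf : Continuous f) {x y : X} (h : asymptoticSetoid f x y) (n : ℕ) :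
    asymptoticSetoid f (f^[n] x) (f^[n] y) := by
  induction n with
  | zero => exact h
  | succ n ih =>
    rw [Function.iterate_succ_apply', Function.iterate_succ_apply']
    exact asymptoticSetoid_map hf ih

theorem tendsto_dist_of_asymptoticSetoid [CompactSpace X] {x y : X} (h : asymptoticSetoid f x y) :
    Tendsto (fun n => dist (f^[n] x) (f^[n] y)) atTop (𝓝 0) := by
  obtain ⟨K, -, hKa, hx, hy⟩ := h
  exact squeeze_zero (fun n => dist_nonneg) (fun n => dist_le_diam_image hx hy _) hKa

theorem not_asymptoticSetoid_iterate [CompactSpace X] [ConnectedSpace X] [Nontrivial X]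
    (hmin : IsMinimalMap f) (hf : Continuous f) {k : ℕ} (hk : 0 < k) (w : X) :
    ¬ asymptoticSetoid f w (f^[k] w) := by
  intro h
  obtain ⟨δ, hδ, hdisp⟩ := hmin.exists_pos_le_dist_iterate hf hk
  refine hδ.not_ge (ge_of_tendsto (tendsto_dist_of_asymptoticSetoid h)
    (Eventually.of_forall fun n => ?_))
  rw [← Function.iterate_add_apply, add_comm, Function.iterate_add_apply]
  exact hdisp _

theorem isConnected_asymptoticClass (x : X) : IsConnected (asymptoticClass f x) := by
  refine ⟨⟨x, (asymptoticSetoid f).refl x⟩, isPreconnected_of_forall x fun y hy => ?_⟩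
  obtain ⟨K, hK, hKa, hx, hy⟩ := hy
  exact ⟨K, fun z hz => ⟨K, hK, hKa, hx, hz⟩, hx, hy, hK.2.isPreconnected⟩

namespace IsFinitelySuslineanContinuum

/-- Otherwise continua `K n` in the class have large images `f^[n] '' K n` for infinitely many `n`.
If two of these met, some point would be equivalent to a positive iterate of itself; so they are
disjoint, against finite suslineanity. -/
theorem eventually_diam_image_closure_asymptoticClass_le [Nontrivial X]
    (hX : IsFinitelySuslineanContinuum X)
    (hf : Continuous f) (hmin : IsMinimalMap f) {c : ℝ} (hc : 0 < c) (x : X) :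
    ∀ᶠ n in atTop, diam (f^[n] '' closure (asymptoticClass f x)) ≤ c := by
  have := hX.compactSpace
  have := hX.connectedSpace
  by_contra hfreq
  have hinf := Nat.frequently_atTop_iff_infinite.1 (not_eventually.1 hfreq)
  generalize hS : {n | ¬ diam (f^[n] '' closure (asymptoticClass f x)) ≤ c} = S at hinf
  have hex : ∀ n : S, ∃ K, IsSubcontinuum K ∧ K ⊆ asymptoticClass f x ∧ c ≤ diam (f^[n] '' K) := by
    rintro ⟨n, hnS⟩
    have hn : ¬ diam (f^[n] '' closure (asymptoticClass f x)) ≤ c := hS.ge hnS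
    by_contra! hcon
    refine hn ((diam_mono (image_closure_subset_closure_image (hf.iterate n))
      isBounded_of_compactSpace).trans ?_)
    rw [diam_closure]
    refine diam_le_of_forall_dist_le hc.le ?_
    rintro _ ⟨a, ha, rfl⟩ _ ⟨b, hb, rfl⟩
    obtain ⟨K, hK, hKa, haK, hbK⟩ :=
      (asymptoticSetoid f).trans ((asymptoticSetoid f).symm ha) hb
    exact (dist_le_diam_image haK hbK _).trans (hcon K hK fun z hz =>
      (asymptoticSetoid f).trans ha ⟨K, hK, hKa, haK, hz⟩).le
  choose K hK hKx hKc using hex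
  have key : ∀ n m : S, (n : ℕ) < m → Disjoint (f^[n] '' K n) (f^[m] '' K m) := by
    intro n m hnm
    rw [Set.disjoint_left]
    rintro _ ⟨u, hu, rfl⟩ ⟨v, hv, huv⟩
    obtain ⟨k, hk⟩ := Nat.exists_eq_add_of_lt hnm
    refine not_asymptoticSetoid_iterate hmin hf k.succ_pos (f^[n] u) ?_
    rw [← Function.iterate_add_apply, ← huv, show k.succ + (n : ℕ) = m by omega]
    exact asymptoticSetoid_iterate hf
      ((asymptoticSetoid f).trans ((asymptoticSetoid f).symm (hKx m hv)) (hKx n hu)) _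
  have hfin := hX.finite_setOf_le_diam (K := fun n : S => f^[n] '' K n)
    (fun n => (hK n).image (hf.iterate n)) (fun n m hnm => by
      rcases lt_or_gt_of_ne (Subtype.coe_ne_coe.2 hnm) with h | h
      · exact key n m h
      · exact (key m n h).symm) hc
  exact hinf (finite_coe_iff.1 (finite_univ_iff.1 (hfin.subset fun n _ => hKc n)))

/-- Asymptotic classes are asymptotic continua. -/
theorem isSubcontinuum_asymptoticClass [Nontrivial X]
    (hX : IsFinitelySuslineanContinuum X)
    (hf : Continuous f) (hmin : IsMinimalMap f) {c : ℝ} (hc : 0 < c)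
    (hstable : ∀ L, IsSubcontinuum L → (∀ n, diam (f^[n] '' L) ≤ c) → IsAsymptoticSet f L)
    (x : X) : IsSubcontinuum (asymptoticClass f x) ∧ IsAsymptoticSet f (asymptoticClass f x) := by
  have := hX.compactSpace
  have hC : IsSubcontinuum (closure (asymptoticClass f x)) :=
    ⟨isClosed_closure.isCompact, (isConnected_asymptoticClass x).closure⟩
  obtain ⟨N, hN⟩ := eventually_atTop.1
    (hX.eventually_diam_image_closure_asymptoticClass_le hf hmin hc x)
  -- The images are small only from time `N` on, so stability is applied to the `N`-th image.
  have hCa : IsAsymptoticSet f (closure (asymptoticClass f x)) :=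
    (hstable _ (hC.image (hf.iterate N)) fun n => by
      rw [image_iterate_image]
      exact hN _ (Nat.le_add_left N n)).of_image_iterate
  have hCx : closure (asymptoticClass f x) = asymptoticClass f x :=
    subset_closure.antisymm' fun y hy =>
      ⟨_, hC, hCa, subset_closure ((asymptoticSetoid f).refl x), hy⟩
  rw [hCx] at hC hCa
  exact ⟨hC, hCa⟩

/-- Only finitely many fibres are large. Near `y` the other large fibres are avoided, and small ones
cannot reach a closed set at distance `ε`. -/
theorem isClosedMap_of_fibers (hX : IsFinitelySuslineanContinuum X) {s : Setoid X}
    (hs : ∀ x, IsSubcontinuum {y | s x y}) : IsClosedMap (Quotient.mk s) := by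
  intro F hF
  rw [← isQuotientMap_quotient_mk'.isClosed_preimage, ← isOpen_compl_iff, isOpen_iff_mem_nhds]
  intro y hy
  have hfib : ∀ q, IsSubcontinuum (Quotient.mk s ⁻¹' {q}) := by
    intro q
    obtain ⟨x, rfl⟩ := Quotient.exists_rep q
    convert hs x using 1
    ext z
    exact Quotient.eq.trans ⟨s.symm, s.symm⟩
  have hyF : y ∉ F := fun h => hy ⟨y, h, rfl⟩
  obtain ⟨ε, hε, hball⟩ := Metric.isOpen_iff.1 hF.isOpen_compl y hyF
  have hfin := hX.finite_setOf_le_diam hfib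
    (fun q r hqr => (disjoint_singleton.2 hqr).preimage _) (half_pos hε)
  have hcl : IsClosed (⋃ q ∈ {q | ε / 2 ≤ diam (Quotient.mk s ⁻¹' {q})} \ {Quotient.mk s y},
      Quotient.mk s ⁻¹' {q}) :=
    (hfin.subset sdiff_subset).isClosed_biUnion fun q _ => (hfib q).1.isClosed
  have hyU : y ∉ ⋃ q ∈ {q | ε / 2 ≤ diam (Quotient.mk s ⁻¹' {q})} \ {Quotient.mk s y},
      Quotient.mk s ⁻¹' {q} := by
    intro h
    obtain ⟨q, hq, hyq⟩ := mem_iUnion₂.1 h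
    exact hq.2 (Eq.symm hyq)
  filter_upwards [ball_mem_nhds y (half_pos hε), hcl.isOpen_compl.mem_nhds hyU]
  rintro z hz hzU ⟨w, hw, hwz⟩
  refine hzU (mem_iUnion₂.2 ⟨Quotient.mk s z, ⟨?_, fun h => hy ⟨w, hw, hwz.trans h⟩⟩, rfl⟩)
  have h1 : dist w z ≤ diam (Quotient.mk s ⁻¹' {Quotient.mk s z}) :=
    dist_le_diam_of_mem (hfib _).1.isBounded hwz rfl
  have h2 : ¬ dist w y < ε := fun h => hball h hw
  have h3 : dist z y < ε / 2 := hz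
  have h4 := dist_triangle w z y
  simp only [mem_ofPred_eq]
  linarith

end IsFinitelySuslineanContinuum

end Asymptotic

/-! ### Monotone factors and the conclusion -/

section Factor

theorem IsMinimalMap.of_semiconj {X Y : Type*} [TopologicalSpace X] [TopologicalSpace Y]
    {f : X → X} {g : Y → Y} {π : X → Y} (hmin : IsMinimalMap f) (hπ : Continuous π)
    (hsurj : Function.Surjective π) (h : Function.Semiconj π f g) : IsMinimalMap g := by
  obtain ⟨x, -⟩ := hmin.1
  refine ⟨⟨π x, mem_univ _⟩, isClosed_univ, mapsTo_univ _ _, fun N _ hne hcl hN => ?_⟩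
  have hpre := hmin.eq_univ (hne.preimage hsurj) (hcl.preimage hπ) fun z hz => by
    rw [mem_preimage, h z]
    exact hN hz
  exact eq_univ_of_forall fun y => by
    obtain ⟨z, rfl⟩ := hsurj y
    exact hpre.ge (mem_univ z)

theorem IsWeaklyMixingMap.of_semiconj {X Y : Type*} [TopologicalSpace X] [TopologicalSpace Y]
    {f : X → X} {g : Y → Y} {π : X → Y} (hwm : IsWeaklyMixingMap f) (hπ : Continuous π)
    (hsurj : Function.Surjective π) (h : Function.Semiconj π f g) : IsWeaklyMixingMap g := by
  intro U V hU hUne hV hVne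
  have hππ : Function.Surjective (Prod.map π π) := hsurj.prodMap hsurj
  have hc : Continuous (Prod.map π π) := hπ.prodMap hπ
  have hs : Function.Semiconj (Prod.map π π) (Prod.map f f) (Prod.map g g) := fun z =>
    Prod.ext (h z.1) (h z.2)
  obtain ⟨n, hn, _, ⟨z, hz, rfl⟩, hzV⟩ := hwm _ _ (hU.preimage hc) (hUne.preimage hππ)
    (hV.preimage hc) (hVne.preimage hππ)
  refine ⟨n, hn, _, ⟨_, hz, rfl⟩, ?_⟩
  rw [← (hs.iterate_right n) z]
  exact hzV

variable {X Y : Type*} [MetricSpace X] [MetricSpace Y] {π : X → Y}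

theorem IsSubcontinuum.preimage [CompactSpace X] (hπ : Continuous π)
    (hfib : ∀ y, IsConnected (π ⁻¹' {y})) {K : Set Y} (hK : IsSubcontinuum K) :
    IsSubcontinuum (π ⁻¹' K) :=
  have hsurj : Function.Surjective π := fun y => (hfib y).nonempty
  ⟨(hK.1.isClosed.preimage hπ).isCompact,
    (hπ.isClosedMap.isQuotientMap hπ hsurj).isCoinducing.isConnected_preimage_of_isClosed hfib
      hK.1.isClosed hK.2⟩

/-- A monotone image of a finitely suslinean continuum is finitely suslinean. -/
theorem IsFinitelySuslineanContinuum.of_monotone (hX : IsFinitelySuslineanContinuum X)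
    (hπ : Continuous π) (hfib : ∀ y, IsConnected (π ⁻¹' {y})) :
    IsFinitelySuslineanContinuum Y := by
  have := hX.compactSpace
  have := hX.connectedSpace
  have hsurj : Function.Surjective π := fun y => (hfib y).nonempty
  refine ⟨hsurj.compactSpace hπ, hsurj.connectedSpace hπ, fun 𝒜 h𝒜 hd ε hε => ?_⟩
  obtain ⟨δ, hδ, hδε⟩ := Metric.uniformContinuous_iff.1
    (CompactSpace.uniformContinuous_of_continuous hπ) (ε / 2) (half_pos hε)
  have hfin := hX.finite_setOf_le_diam (K := fun A : 𝒜 => π ⁻¹' A)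
    (fun A => (h𝒜 A A.2).preimage hπ hfib)
    (fun A B hAB => (hd A.2 B.2 fun h => hAB (Subtype.ext h)).preimage π) hδ
  refine ⟨hfin.toFinset, fun A hA => ?_⟩
  rw [Finite.mem_toFinset, mem_ofPred_eq, not_le] at hA
  refine (diam_le_of_forall_dist_le (half_pos hε).le fun y hy z hz => ?_).trans_lt
    (half_lt_self hε)
  obtain ⟨u, rfl⟩ := hsurj y
  obtain ⟨v, rfl⟩ := hsurj z
  exact (hδε ((dist_le_diam_of_mem (s := π ⁻¹' A) isBounded_of_compactSpace hy hz).trans_lt hA)).le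

end Factor

/-- A minimal weakly mixing map of a finitely suslinean continuum has no factor whose fibers are the
asymptotic classes. -/
theorem IsFinitelySuslineanContinuum.not_isWeaklyMixingMap_of_factor {X Y : Type*} [MetricSpace X]
    [MetricSpace Y] [Nontrivial Y] (hX : IsFinitelySuslineanContinuum X) {f : X → X}
    (hf : Continuous f) (hmin : IsMinimalMap f) {π : X → Y} {g : Y → Y} (hπ : Continuous π)
    (hg : Continuous g) (hsemi : Function.Semiconj π f g) (hfib : ∀ y, IsConnected (π ⁻¹' {y}))
    (hclass : ∀ x y, asymptoticSetoid f x y → π x = π y) : ¬ IsWeaklyMixingMap f := by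
  intro hwm
  have hsurj : Function.Surjective π := fun y => (hfib y).nonempty
  have hY := hX.of_monotone hπ hfib
  have := hX.compactSpace
  have := hY.compactSpace
  have := hY.connectedSpace
  have hgmin := hmin.of_semiconj hπ hsurj hsemi
  have hgwm := hwm.of_semiconj hπ hsurj hsemi
  obtain ⟨p, q, hpq⟩ := exists_pair_ne Y
  have hpq' : 0 < dist p q := dist_pos.2 hpq
  obtain ⟨K, hK, hKc, u, hu, v, hv, huv⟩ := hgmin.exists_nontrivial_diam_le hg
    (by positivity : 0 < dist p q / 4)
  have hKa := hY.isAsymptoticSet_of_diam_le hg hgmin hgwm hpq (by linarith) hK hKc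
  have hK' := hK.preimage hπ hfib
  -- Otherwise a coincidence of orbits in the preimage projects to points of `g^[j] '' K` that
  -- `g^[k]` moves by at least `δ`, though these images shrink.
  have hKa' : IsAsymptoticSet f (π ⁻¹' K) := by
    refine isAsymptoticSet_of_forall_not_frequently fun ε hε hfreq => ?_
    obtain ⟨n, k, hk, a, ha, b, hb, hab⟩ := hX.exists_iterate_eq hf hK' hε hfreq
    obtain ⟨δ, hδ, hdisp⟩ := hgmin.exists_pos_le_dist_iterate hg hk
    refine hδ.not_ge (ge_of_tendsto hKa ?_)
    filter_upwards [eventually_ge_atTop n] with j hj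
    refine (hdisp (g^[j] (π b))).trans ?_
    rw [← (hsemi.iterate_right j) b, ← (hsemi.iterate_right k) _, hab j hj,
      (hsemi.iterate_right j) a, (hsemi.iterate_right j) b]
    exact dist_le_diam_image (X := Y) hb ha _
  obtain ⟨a, rfl⟩ := hsurj u
  obtain ⟨b, rfl⟩ := hsurj v
  exact huv (hclass a b ⟨_, hK', hKa', hu, hv⟩)

theorem mainTheorem4 {X : Type*} [MetricSpace X] [Nontrivial X]
    (hX : IsFinitelySuslineanContinuum X) (f : X → X) (hf : Continuous f)
    (hmin : IsMinimalMap f) : ¬ IsWeaklyMixingMap f := by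
  intro hwm
  have := hX.compactSpace
  have := hX.connectedSpace
  obtain ⟨p, q, hpq⟩ := exists_pair_ne X
  have hpq' : 0 < dist p q := dist_pos.2 hpq
  have hclass := hX.isSubcontinuum_asymptoticClass hf hmin (by positivity : 0 < dist p q / 4)
    fun L hL hLc => hX.isAsymptoticSet_of_diam_le hf hmin hwm hpq (by linarith) hL hLc
  let Y := Quotient (asymptoticSetoid f)
  let π : X → Y := Quotient.mk _
  have hπ : Continuous π := continuous_quotient_mk'
  have hsurj : Function.Surjective π := Quotient.mk_surjective
  have hcl : IsClosedMap π := hX.isClosedMap_of_fibers fun x => (hclass x).1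
  have : T2Space Y := hcl.t2Space hπ hsurj
  have : SecondCountableTopology Y := hcl.secondCountableTopology hπ hsurj
  have : CompactSpace Y := hsurj.compactSpace hπ
  have hfib : ∀ y, IsConnected (π ⁻¹' {y}) := by
    intro y
    obtain ⟨x, rfl⟩ := hsurj y
    convert isConnected_asymptoticClass (f := f) x using 1
    ext z
    exact Quotient.eq.trans ⟨(asymptoticSetoid f).symm, (asymptoticSetoid f).symm⟩
  -- A single class would be all of `X`, whose images under the surjection `f` never shrink.
  have : Nontrivial Y := by
    by_contra hY
    rw [not_nontrivial_iff_subsingleton] at hY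
    have huniv : asymptoticClass f p = univ :=
      eq_univ_of_forall fun x => Quotient.exact (Subsingleton.elim (π p) (π x))
    have hlim : Tendsto (fun n => diam (f^[n] '' asymptoticClass f p)) atTop (𝓝 0) :=
      (hclass p).2
    refine hpq'.not_ge (ge_of_tendsto hlim (Eventually.of_forall fun n => ?_))
    rw [huniv, image_univ, ((hmin.surjective hf).iterate n).range_eq]
    exact dist_le_diam_of_mem isBounded_of_compactSpace (mem_univ p) (mem_univ q)
  let g : Y → Y := Quotient.map f fun _ _ h => asymptoticSetoid_map hf h
  have hg : Continuous g := hf.quotient_map' _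
  let _ : MetricSpace Y := TopologicalSpace.metrizableSpaceMetric Y
  exact hX.not_isWeaklyMixingMap_of_factor hf hmin hπ hg (fun _ => rfl) hfib
    (fun _ _ h => Quotient.sound h) hwm
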